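/- All Banach spaces are real. A Banach space $X$ is locally uniformly convex if for all $x$ and $(y_n)_{n\in\mathbb N}$ in its unit sphere, $\left\|\frac{x+y_n}{2}\right\|\to 1$ implies $\|x-y_n\|\to 0$. A nearest point map onto a set $K\subset X$ is a map $R\colon X\to K$ such that $\|x-R(x)\|=\inf_{k\in K}\|x-k\|$ for every $x\in X$. Say that $X$ has property $(P)$ if $X$ is separable and locally uniformly convex and, for every compact convex set $K\subset X$ with at least two points, there is a unique nearest point map from $X$ onto $K$, and this map is continuous but not uniformly continuous. There exists an infinite-dimensional Banach space with property $(P)$. Moreover, for every $\varepsilon>0$ and every infinite-dimensional separable Banach space $X$, there exist a Banach space $Y$ with property $(P)$ and a linear isomorphism $T\colon X\to Y$ such that $\|T\|\,\|T^{-1}\|\le 1+\varepsilon$. -/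

import Mathlib

open Filter Topology

universe u

/-- Local uniform convexity of a real normed space, in terms of sequences in the unit sphere. -/
def LocallyUniformlyConvex (X : Type*) [NormedAddCommGroup X] [NormedSpace ℝ X] : Prop :=
  ∀ x : X, ‖x‖ = 1 → ∀ y : ℕ → X, (∀ n, ‖y n‖ = 1) →
    Tendsto (fun n => ‖(1 / 2 : ℝ) • (x + y n)‖) atTop (𝓝 1) →
    Tendsto (fun n => ‖x - y n‖) atTop (𝓝 0)

/-- `R : M → C` is a nearest point map onto `C` if `d(x, R x) = d(x, C)` for every `x`.
The codomain `C` of such a map is nonempty as soon as `M` is, so that `Metric.infDist` is the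
genuine infimum. -/
def IsNearestPointMap {M : Type*} [MetricSpace M] (C : Set M) (R : M → C) : Prop :=
  ∀ x : M, dist x (R x : M) = Metric.infDist x C

/-- For every compact convex subset `K` with at least two points there is one and only one nearest
point map onto `K`, and it is continuous but not uniformly continuous. -/
def NearestPointMapsNotUniform (X : Type*) [NormedAddCommGroup X] [NormedSpace ℝ X] : Prop :=
  ∀ K : Set X, IsCompact K → Convex ℝ K → K.Nontrivial →
    ∃ R : X → K, IsNearestPointMap K R ∧ (∀ R' : X → K, IsNearestPointMap K R' → R' = R) ∧
      Continuous R ∧ ¬ UniformContinuous R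

/-- `X` and `Y` are `c`-isomorphic: some linear isomorphism `T` has `‖T‖ ‖T⁻¹‖ ≤ c`. -/
def IsomorphicWithConstant (c : ℝ) (X Y : Type*) [NormedAddCommGroup X] [NormedSpace ℝ X]
    [NormedAddCommGroup Y] [NormedSpace ℝ Y] : Prop :=
  ∃ T : X ≃L[ℝ] Y, ‖(T : X →L[ℝ] Y)‖ * ‖(T.symm : Y →L[ℝ] X)‖ ≤ c

/-! The new norm is the ℓ² sum of `head` and of weighted seminorms `layer n`. The layers give local
uniform convexity by Kadec's compactness argument (`sqSum_tendsto_of_midpoint`). Strict convexity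
and compactness then yield existence, uniqueness and continuity of nearest point maps.

Uniform continuity is destroyed by `head`, the maximum of the old norm and of all ridges `(1 +
2θ)(|φ j| + θ/112 |kink j|)`. Far out in the direction `e j`, `head` is the `j`-th ridge
(`head_eq`). There the layers up to `j` see only `φ j`, which is nearly zero on a compact `K` since
`φ` is weak* null, and the later layers have tiny weight. Hence a nearest point `k` to `t • e j + v`
almost minimises `|kink j (v - k)|` (`abs_slope_sub_le`).

With `M = factor j` and `f i = slope j`, `kink j` is nearly `M⁻¹ f i` on `K`, yet it is at least
`1/2` at `e (j + 1)`. Moving `v` by `O(1/M)` along `e (j + 1)` therefore carries the value of `f i`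
at the nearest point from about `f i k₁` to about `f i k₂`. Every pair `(i, M)` with `M - 8` a
natural number recurs for arbitrarily large `j`, so `f i` may be chosen to separate `k₁` and `k₂`,
and then `M` as large as desired (`not_uniform`). -/

/-! ### Almost normalised triangular systems and separating functionals -/

section Biorthogonal

variable {X : Type*} [NormedAddCommGroup X] [NormedSpace ℝ X]

/-- Riesz's lemma with a functional that vanishes on the subspace. -/
theorem exists_riesz_pair (hX : ¬ FiniteDimensional ℝ X) (F : Submodule ℝ X)
    [FiniteDimensional ℝ F] {δ : ℝ} (hδ : 0 < δ) :
    ∃ (w : X) (ψ : X →L[ℝ] ℝ), ‖w‖ ≤ 1 + δ ∧ ‖ψ‖ ≤ 1 ∧ ψ w = 1 ∧ ∀ y ∈ F, ψ y = 0 := by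
  have hF : IsClosed (F : Set X) := F.closed_of_finiteDimensional
  have hne : ∃ x, x ∉ F := by
    by_contra! h
    apply hX
    have : F = ⊤ := (Submodule.eq_top_iff').2 h
    subst this
    exact Module.Finite.equiv (Submodule.topEquiv (R := ℝ) (M := X))
  have hr : (1 + δ)⁻¹ < 1 := inv_lt_one_of_one_lt₀ (by linarith)
  obtain ⟨x, hxF, hx⟩ := riesz_lemma hF hne hr
  have hx0 : x ≠ 0 := fun h => hxF (h ▸ F.zero_mem)
  have hnx : 0 < ‖x‖ := norm_pos_iff.2 hx0
  have hq : (1 + δ)⁻¹ * ‖x‖ ≤ ‖F.mkQ x‖ := by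
    refine le_of_forall_pos_lt_add fun ε hε => ?_
    obtain ⟨m, hm, hm'⟩ := Submodule.Quotient.norm_mk_lt (F.mkQ x) hε
    have : x - m ∈ F := (Submodule.Quotient.eq F).1 (by rw [hm]; rfl)
    have := hx _ this
    rw [sub_sub_cancel] at this
    linarith
  have hq0 : 0 < ‖F.mkQ x‖ := lt_of_lt_of_le (by positivity) hq
  obtain ⟨g, hg, hgx⟩ := exists_dual_vector'' ℝ (F.mkQ x)
  refine ⟨‖F.mkQ x‖⁻¹ • x, g.comp F.mkQL, ?_, ?_, ?_, ?_⟩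
  · rw [norm_smul, norm_inv, norm_norm, inv_mul_le_iff₀ hq0]
    rw [inv_mul_le_iff₀ (by linarith)] at hq
    linarith
  · refine ContinuousLinearMap.opNorm_le_bound _ zero_le_one fun y => ?_
    calc ‖g (F.mkQL y)‖ ≤ ‖g‖ * ‖F.mkQL y‖ := g.le_opNorm _
      _ ≤ 1 * ‖y‖ := mul_le_mul hg (Submodule.Quotient.norm_mk_le F y) (norm_nonneg _) zero_le_one
  · change g (F.mkQ (‖F.mkQ x‖⁻¹ • x)) = 1
    rw [map_smul, map_smul, hgx]
    exact inv_mul_cancel₀ hq0.ne'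
  · intro y hy
    have : F.mkQ y = 0 := by simpa using hy
    change g (F.mkQ y) = 0
    rw [this, map_zero]

theorem exists_riesz_sequence (hX : ¬ FiniteDimensional ℝ X) (d : ℕ → X) {δ : ℝ} (hδ : 0 < δ) :
    ∃ (w : ℕ → X) (ψ : ℕ → X →L[ℝ] ℝ), (∀ n, ‖w n‖ ≤ 1 + δ) ∧ (∀ n, ‖ψ n‖ ≤ 1) ∧
      (∀ n, ψ n (w n) = 1) ∧ (∀ m n, m < n → ψ n (w m) = 0) ∧ ∀ m n, m < n → ψ n (d m) = 0 := by
  classical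
  -- The natural number in each triple says how many `d m` are annihilated. It increases strictly,
  -- so it is at least `n` at stage `n`.
  obtain ⟨s, hs, hs'⟩ := exists_seq_of_forall_finset_exists
    (fun p : ℕ × X × (X →L[ℝ] ℝ) => ‖p.2.1‖ ≤ 1 + δ ∧ ‖p.2.2‖ ≤ 1 ∧ p.2.2 p.2.1 = 1 ∧
      ∀ m < p.1, p.2.2 (d m) = 0)
    (fun p q => p.1 < q.1 ∧ q.2.2 p.2.1 = 0) (fun S _ => by
      set k := S.sup (fun p => p.1) + 1
      let G : Set X := (S.image fun p => p.2.1 : Finset X) ∪ ((Finset.range k).image d : Finset X)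
      have hG : G.Finite := (Finset.finite_toSet _).union (Finset.finite_toSet _)
      have := FiniteDimensional.span_of_finite ℝ hG
      obtain ⟨w, ψ, hw, hψ, hψw, h0⟩ := exists_riesz_pair hX (Submodule.span ℝ G) hδ
      refine ⟨(k, w, ψ), ⟨hw, hψ, hψw, fun m hm => h0 _ (Submodule.subset_span (Or.inr ?_))⟩,
        fun p hp => ⟨Nat.lt_succ_of_le (Finset.le_sup (f := fun p => p.1) hp),
          h0 _ (Submodule.subset_span (Or.inl ?_))⟩⟩
      · exact Finset.mem_coe.2 (Finset.mem_image_of_mem _ (Finset.mem_range.2 hm))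
      · exact Finset.mem_coe.2 (Finset.mem_image_of_mem (fun p => p.2.1) hp))
  have hmono : StrictMono fun n => (s n).1 := fun m n h => (hs' m n h).1
  exact ⟨fun n => (s n).2.1, fun n => (s n).2.2, fun n => (hs n).1, fun n => (hs n).2.1,
    fun n => (hs n).2.2.1, fun m n h => (hs' m n h).2,
    fun m n h => (hs n).2.2.2 m (h.trans_le (hmono.le_apply))⟩

theorem tendsto_apply_zero_of_dense {φ : ℕ → X →L[ℝ] ℝ} {C : ℝ} (hφ : ∀ n, ‖φ n‖ ≤ C)
    {d : ℕ → X} (hd : DenseRange d) (h : ∀ m n, m < n → φ n (d m) = 0) (x : X) :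
    Tendsto (fun n => φ n x) atTop (𝓝 0) := by
  have hC : 0 ≤ C := (norm_nonneg _).trans (hφ 0)
  rw [Metric.tendsto_atTop]
  intro ε hε
  obtain ⟨m, hm⟩ := hd.exists_dist_lt x (ε := ε / (C + 1)) (by positivity)
  refine ⟨m + 1, fun n hn => ?_⟩
  have h1 : φ n x = φ n (x - d m) := by rw [map_sub, h m n hn, sub_zero]
  rw [dist_zero_right, h1]
  calc ‖φ n (x - d m)‖ ≤ C * ‖x - d m‖ := (φ n).le_of_opNorm_le (hφ n) _
    _ ≤ C * (ε / (C + 1)) := by rw [← dist_eq_norm]; gcongr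
    _ < ε := by
      rw [mul_div_assoc', div_lt_iff₀ (by positivity)]; nlinarith

/-- An almost normalised system whose functionals are weak* null and are uniformly smaller than `1`
at the other vectors. -/
theorem exists_separated_system [TopologicalSpace.SeparableSpace X]
    (hX : ¬ FiniteDimensional ℝ X) {θ : ℝ} (hθ : 0 < θ) (hθ1 : θ ≤ 1) :
    ∃ (e : ℕ → X) (φ : ℕ → X →L[ℝ] ℝ), (∀ n, ‖e n‖ ≤ 1 + θ) ∧ (∀ n, ‖φ n‖ ≤ 1 + θ) ∧
      (∀ n, φ n (e n) = 1) ∧ (∀ m n, m < n → φ n (e m) = 0) ∧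
      (∀ m n, m ≠ n → |φ m (e n)| ≤ 1 - θ / 4) ∧ ∀ x, Tendsto (fun n => φ n x) atTop (𝓝 0) := by
  classical
  have hd := TopologicalSpace.denseRange_denseSeq X
  set d := TopologicalSpace.denseSeq X
  obtain ⟨w, ψ, hw, hψ, hψw, hψ0, hψd⟩ := exists_riesz_sequence hX d (δ := θ / 8) (by positivity)
  have hb : ∀ a b, |ψ a (w b)| ≤ 1 + θ / 8 := fun a b => by
    have := (ψ a).le_of_opNorm_le (hψ a) (w b)
    rw [Real.norm_eq_abs] at this
    linarith [hw b]
  -- An ultrafilter gives all the sequences `ψ a (w b)` limits in `b` at once, and decides whether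
  -- `|l a| ≤ 1 / 2` for most `a`.
  let U := hyperfilter ℕ
  have hlim : ∀ a, ∃ l : ℝ, |l| ≤ 1 + θ / 8 ∧ Tendsto (fun b => ψ a (w b)) U (𝓝 l) := fun a => by
    obtain ⟨l, hl, hl'⟩ := (isCompact_Icc (a := -(1 + θ / 8)) (b := 1 + θ / 8)).ultrafilter_le_nhds
      (U.map fun b => ψ a (w b)) (by
        rw [le_principal_iff, Ultrafilter.coe_map]
        exact Filter.mem_map.2 (Filter.univ_mem' fun b => abs_le.1 (hb a b)))
    exact ⟨l, abs_le.2 hl, hl'⟩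
  choose l hl hlt using hlim
  have hev : ∀ a, ∀ᶠ b in (U : Filter ℕ), a < b := fun a =>
    Nat.hyperfilter_le_atTop (eventually_gt_atTop a)
  let Q : ℕ → (X →L[ℝ] ℝ) → Prop := fun a φ => ‖φ‖ ≤ 1 + θ ∧ φ (w a) = 1 ∧
    (∀ m < a, φ (w m) = 0) ∧ (∀ m < a, φ (d m) = 0) ∧ ∀ᶠ b in (U : Filter ℕ), |φ (w b)| ≤ 1 - θ / 4
  have hQ : ∀ᶠ a in (U : Filter ℕ), ∃ φ, Q a φ := by
    by_cases hc : ∀ᶠ a in (U : Filter ℕ), |l a| ≤ 1 / 2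
    · filter_upwards [hc] with a ha
      refine ⟨ψ a, (hψ a).trans (by linarith), hψw a, fun m hm => hψ0 m a hm,
        fun m hm => hψd m a hm, ?_⟩
      have : |l a| < 1 - θ / 4 := by linarith
      filter_upwards [(hlt a).abs.eventually_lt_const this] with b hb using hb.le
    · have hc' : ∀ᶠ a in (U : Filter ℕ), ¬ |l a| ≤ 1 / 2 := Ultrafilter.eventually_not.2 hc
      filter_upwards [hc'] with a ha
      -- Subtracting `θ s ψ a'` with the right sign lowers a limit of at most `1 + θ/8` by more than
      -- `θ/2`. Since `a < a'`, the functional `ψ a'` vanishes at `w a` and wherever `ψ a` had to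
      -- vanish, so nothing else is lost.
      obtain ⟨a', haa', ha'⟩ := ((hev a).and hc').exists
      push Not at ha ha'
      obtain ⟨s, hs1, hs2⟩ : ∃ s : ℝ, |s| = 1 ∧ |l a - θ * s * l a'| = abs (|l a| - θ * |l a'|) := by
        rcases abs_cases (l a) with ⟨h1, -⟩ | ⟨h1, -⟩ <;>
          rcases abs_cases (l a') with ⟨h2, -⟩ | ⟨h2, -⟩ <;> rw [h1, h2]
        · exact ⟨1, by simp, by ring_nf⟩
        · exact ⟨-1, by simp, by ring_nf⟩
        · exact ⟨-1, by simp, by rw [← abs_neg]; ring_nf⟩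
        · exact ⟨1, by simp, by rw [← abs_neg]; ring_nf⟩
      refine ⟨ψ a - (θ * s) • ψ a', ?_, ?_, ?_, ?_, ?_⟩
      · refine (norm_sub_le _ _).trans (add_le_add (hψ a) ?_)
        rw [norm_smul, norm_mul, Real.norm_eq_abs s, hs1, Real.norm_of_nonneg hθ.le]
        nlinarith [hψ a']
      · simp [hψw a, hψ0 a a' haa']
      · intro m hm
        simp [hψ0 m a hm, hψ0 m a' (hm.trans haa')]
      · intro m hm
        simp [hψd m a hm, hψd m a' (hm.trans haa')]
      · have hlim : Tendsto (fun b => |(ψ a - (θ * s) • ψ a') (w b)|) U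
            (𝓝 |l a - θ * s * l a'|) := by
          simpa using ((hlt a).sub ((hlt a').const_mul (θ * s))).abs
        have : |l a - θ * s * l a'| < 1 - θ / 4 := by
          rw [hs2, abs_lt]
          have h1 := hl a
          have h2 := hl a'
          constructor <;> nlinarith
        filter_upwards [hlim.eventually_lt_const this] with b hb using hb.le
  -- Finitely many earlier functionals are simultaneously below the bound at `U`-most `w b`, so the
  -- subsequence can be continued.
  obtain ⟨s, hs, hs'⟩ := exists_seq_of_forall_finset_exists
    (fun p : ℕ × (X →L[ℝ] ℝ) => Q p.1 p.2) (fun p q => p.1 < q.1 ∧ |p.2 (w q.1)| ≤ 1 - θ / 4)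
    (fun S hS => by
      have h1 : ∀ᶠ b in (U : Filter ℕ), ∀ p ∈ S, p.1 < b ∧ |p.2 (w b)| ≤ 1 - θ / 4 :=
        (Filter.eventually_all_finset S).2 fun p hp => (hev p.1).and (hS p hp).2.2.2.2
      obtain ⟨b, hb, φ, hφ⟩ := (h1.and hQ).exists
      exact ⟨(b, φ), hφ, hb⟩)
  have hmono : StrictMono fun n => (s n).1 := fun m n h => (hs' m n h).1
  have h0 : ∀ m n, m < n → (s n).2 (w (s m).1) = 0 := fun m n h => (hs n).2.2.1 _ (hmono h)
  refine ⟨fun n => w (s n).1, fun n => (s n).2, fun n => (hw _).trans (by linarith),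
    fun n => (hs n).1, fun n => (hs n).2.1, h0, fun m n hmn => ?_, fun x => ?_⟩
  · rcases lt_or_gt_of_ne hmn with h | h
    · exact (hs' m n h).2
    · rw [h0 n m h, abs_zero]; linarith
  · exact tendsto_apply_zero_of_dense (fun n => (hs n).1) hd
      (fun m n h => (hs n).2.2.2.1 m (h.trans_le hmono.le_apply)) x

/-- A sequence in the dual unit ball that separates points. -/
theorem exists_separating_sequence [TopologicalSpace.SeparableSpace X] :
    ∃ f : ℕ → X →L[ℝ] ℝ, (∀ n, ‖f n‖ ≤ 1) ∧ ∀ x, (∀ n, f n x = 0) → x = 0 := by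
  have hd := TopologicalSpace.denseRange_denseSeq X
  set d := TopologicalSpace.denseSeq X
  choose f hf hfd using fun n => exists_dual_vector'' ℝ (d n)
  refine ⟨f, hf, fun x hx => ?_⟩
  by_contra hne
  obtain ⟨n, hn⟩ := hd.exists_dist_lt x (ε := ‖x‖ / 2) (by have := norm_pos_iff.2 hne; positivity)
  -- `f n` norms `d n` and vanishes at `x`. The inequality is absurd for `d n` close to `x`.
  have h1 : ‖d n‖ ≤ ‖d n - x‖ := by
    have h2 : f n (d n - x) = ‖d n‖ := by rw [map_sub, hx, hfd, sub_zero]; rfl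
    have h3 := (f n).le_of_opNorm_le (hf n) (d n - x)
    rw [h2, norm_norm, one_mul] at h3
    exact h3
  rw [dist_eq_norm, norm_sub_rev] at hn
  have h4 := norm_sub_norm_le x (d n)
  rw [norm_sub_rev] at h4
  linarith

end Biorthogonal

/-! ### Tail maxima and square sums of seminorms -/

section SeminormSums

variable {E : Type*} [AddCommGroup E] [Module ℝ E]

/-- The maximum of `b` and of the `s j` with `n ≤ j`. -/
noncomputable def tailMax (b : Seminorm ℝ E) (s : ℕ → Seminorm ℝ E) (n : ℕ) : Seminorm ℝ E :=
  b ⊔ ⨆ j, s (n + j)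

/-- The bound `hs` matters: the supremum of an unbounded family of seminorms is zero by default. -/
theorem tailMax_apply {b : Seminorm ℝ E} {s : ℕ → Seminorm ℝ E}
    (hs : ∀ x, ∃ C, ∀ j, s j x ≤ C) (n : ℕ) (x : E) :
    tailMax b s n x = max (b x) (⨆ j, s (n + j) x) := by
  rw [tailMax, Seminorm.sup_apply, Seminorm.iSup_apply]
  rw [Seminorm.bddAbove_range_iff]
  intro x
  obtain ⟨C, hC⟩ := hs x
  exact ⟨C, by rintro _ ⟨j, rfl⟩; exact hC _⟩

theorem le_tailMax (b : Seminorm ℝ E) (s : ℕ → Seminorm ℝ E) (n : ℕ) (x : E) :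
    b x ≤ tailMax b s n x := by
  have : b ≤ tailMax b s n := le_sup_left
  exact this x

theorem le_tailMax_of_le {b : Seminorm ℝ E} {s : ℕ → Seminorm ℝ E}
    (hs : ∀ x, ∃ C, ∀ j, s j x ≤ C) {n j : ℕ} (h : n ≤ j) (x : E) :
    s j x ≤ tailMax b s n x := by
  rw [tailMax_apply hs]
  obtain ⟨C, hC⟩ := hs x
  obtain ⟨k, rfl⟩ := Nat.exists_eq_add_of_le h
  exact le_max_of_le_right
    (le_ciSup (f := fun j => s (n + j) x) ⟨C, by rintro _ ⟨j, rfl⟩; exact hC _⟩ k)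

theorem tailMax_le {b : Seminorm ℝ E} {s : ℕ → Seminorm ℝ E}
    (hs : ∀ x, ∃ C, ∀ j, s j x ≤ C) {n : ℕ} {x : E} {c : ℝ} (hb : b x ≤ c)
    (h : ∀ j, n ≤ j → s j x ≤ c) : tailMax b s n x ≤ c := by
  rw [tailMax_apply hs]
  exact max_le hb (ciSup_le fun j => h _ (Nat.le_add_right _ _))

theorem tailMax_eq {b : Seminorm ℝ E} {s : ℕ → Seminorm ℝ E}
    (hs : ∀ x, ∃ C, ∀ j, s j x ≤ C) {n j : ℕ} (hj : n ≤ j) {x : E} (hb : b x ≤ s j x)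
    (h : ∀ i, i ≠ j → s i x ≤ s j x) : tailMax b s n x = s j x := by
  refine le_antisymm (tailMax_le hs hb fun i _ => ?_) (le_tailMax_of_le hs hj x)
  by_cases hi : i = j
  · rw [hi]
  · exact h i hi

variable (p : ℕ → Seminorm ℝ E)

theorem sqrt_tsum_add_le (hp : ∀ x, Summable fun n => p n x ^ 2) (x y : E) :
    √(∑' n, p n (x + y) ^ 2) ≤ √(∑' n, p n x ^ 2) + √(∑' n, p n y ^ 2) := by
  have key := Real.Lp_add_le_tsum_of_nonneg (p := 2) one_le_two (fun n => apply_nonneg (p n) x)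
    (fun n => apply_nonneg (p n) y) (by simpa using hp x) (by simpa using hp y)
  simp only [Real.rpow_two, ← Real.sqrt_eq_rpow] at key
  refine le_trans (Real.sqrt_le_sqrt ?_) key.2
  exact (hp _).tsum_le_tsum (fun n => pow_le_pow_left₀ (apply_nonneg _ _) (map_add_le_add _ _ _) 2)
    key.1

/-- The seminorm `x ↦ (∑ (p n x)²)^(1/2)`. -/
noncomputable def sqSum (hp : ∀ x, Summable fun n => p n x ^ 2) : Seminorm ℝ E :=
  Seminorm.of (fun x => √(∑' n, p n x ^ 2)) (sqrt_tsum_add_le p hp) fun a x => by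
    simp only [map_smul_eq_mul, mul_pow, tsum_mul_left]
    rw [Real.sqrt_mul (sq_nonneg _), Real.sqrt_sq (norm_nonneg _)]

variable {p}

theorem sqSum_sq (hp : ∀ x, Summable fun n => p n x ^ 2) (x : E) :
    sqSum p hp x ^ 2 = ∑' n, p n x ^ 2 :=
  Real.sq_sqrt (tsum_nonneg fun _ => sq_nonneg _)

theorem le_sqSum (hp : ∀ x, Summable fun n => p n x ^ 2) (n : ℕ) (x : E) :
    p n x ≤ sqSum p hp x :=
  Real.le_sqrt_of_sq_le ((hp x).le_tsum n fun _ _ => sq_nonneg _)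

/-- The convexity defect of the square of `sqSum` bounds the defect of each term. -/
theorem sqSum_defect (hp : ∀ x, Summable fun n => p n x ^ 2) (n : ℕ) (x y : E) :
    (p n x - p n y) ^ 2 + ((p n x + p n y) ^ 2 - p n (x + y) ^ 2) ≤
      2 * sqSum p hp x ^ 2 + 2 * sqSum p hp y ^ 2 - sqSum p hp (x + y) ^ 2 := by
  have hsum := (((hp x).mul_left 2).add ((hp y).mul_left 2)).sub (hp (x + y))
  -- With `a`, `b`, `c` the values at `x`, `y`, `x + y`: `2a² + 2b² - c² = (a - b)² + ((a + b)² -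
  -- c²)`, and both summands are nonnegative.
  have h0 : ∀ m, 0 ≤ 2 * p m x ^ 2 + 2 * p m y ^ 2 - p m (x + y) ^ 2 := fun m => by
    have h1 := map_add_le_add (p m) x y
    have h2 := apply_nonneg (p m) (x + y)
    nlinarith [sq_nonneg (p m x - p m y)]
  have := hsum.le_tsum n fun m _ => h0 m
  rw [(((hp x).mul_left 2).add ((hp y).mul_left 2)).tsum_sub (hp (x + y)),
    ((hp x).mul_left 2).tsum_add ((hp y).mul_left 2), tsum_mul_left, tsum_mul_left,
    ← sqSum_sq hp, ← sqSum_sq hp, ← sqSum_sq hp] at this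
  linarith

end SeminormSums

/-! ### Kadec's criterion -/

section Kadec

variable {X : Type*} [NormedAddCommGroup X] [NormedSpace ℝ X]

/-- A bounded piece of a line is totally bounded; its net, together with the finitely many initial
terms, serves for the sequence. The line may change with `ε`. -/
theorem totallyBounded_range_of_near_line {y : ℕ → X} {B : ℝ} (hB : ∀ k, ‖y k‖ ≤ B)
    (h : ∀ ε > 0, ∃ v : X, ∀ᶠ k in atTop, ∃ r : ℝ, ‖y k - r • v‖ < ε) :
    TotallyBounded (Set.range y) := by
  rw [Metric.totallyBounded_iff]
  intro ε hε
  obtain ⟨v, hv⟩ := h (ε / 2) (by positivity)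
  obtain ⟨k₀, hk₀⟩ := eventually_atTop.1 hv
  have hc : IsCompact ((fun z : Submodule.span ℝ {v} => (z : X)) '' Metric.closedBall 0 (B + ε)) :=
    (isCompact_closedBall _ _).image continuous_subtype_val
  obtain ⟨t, ht, htc⟩ := Metric.totallyBounded_iff.1 hc.totallyBounded (ε / 2) (by positivity)
  refine ⟨t ∪ y '' Set.Iio k₀, ht.union ((Set.finite_Iio k₀).image y), ?_⟩
  rintro _ ⟨k, rfl⟩
  rw [Set.mem_iUnion₂]
  by_cases hk : k < k₀
  · exact ⟨y k, Or.inr ⟨k, hk, rfl⟩, Metric.mem_ball_self hε⟩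
  · obtain ⟨r, hr⟩ := hk₀ k (not_lt.1 hk)
    have hmem : r • v ∈ (fun z : Submodule.span ℝ {v} => (z : X)) '' Metric.closedBall 0 (B + ε) := by
      refine ⟨⟨r • v, Submodule.smul_mem _ _ (Submodule.mem_span_singleton_self v)⟩, ?_, rfl⟩
      rw [mem_closedBall_zero_iff]
      change ‖r • v‖ ≤ B + ε
      have := norm_sub_norm_le (r • v) (y k)
      rw [norm_sub_rev] at this
      linarith [hB k]
    obtain ⟨z, hz, hz'⟩ := Set.mem_iUnion₂.1 (htc hmem)
    refine ⟨z, Or.inl hz, ?_⟩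
    rw [Metric.mem_ball] at hz' ⊢
    calc dist (y k) z ≤ dist (y k) (r • v) + dist (r • v) z := dist_triangle _ _ _
      _ < ε := by rw [dist_eq_norm]; linarith

theorem Seminorm.tendsto_of_le_norm {q : Seminorm ℝ X} {C : ℝ} (hq : ∀ x, q x ≤ C * ‖x‖)
    {ι : Type*} {l : Filter ι} {y : ι → X} {x : X} (h : Tendsto y l (𝓝 x)) :
    Tendsto (fun k => q (y k)) l (𝓝 (q x)) := by
  rw [tendsto_iff_dist_tendsto_zero]
  have h0 : Tendsto (fun k => C * ‖y k - x‖) l (𝓝 0) := by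
    simpa using (tendsto_iff_norm_sub_tendsto_zero.1 h).const_mul C
  exact squeeze_zero (fun _ => dist_nonneg)
    (fun k => (abs_sub_map_le_sub q _ _).trans (hq _)) h0

/-- Kadec's criterion for local uniform convexity of the square sum of a sequence of seminorms. -/
theorem sqSum_tendsto_of_midpoint [CompleteSpace X] {p : ℕ → Seminorm ℝ X}
    (hp : ∀ x, Summable fun n => p n x ^ 2) {C : ℝ} (hC : ∀ x, sqSum p hp x ≤ C * ‖x‖)
    (h1 : ∀ x, ‖x‖ ≤ sqSum p hp x)
    (hT : ∀ x, ∀ ε > 0, ∃ (n : ℕ) (v : X) (c : ℝ), p n x < c ∧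
      ∀ z, p n z < c → ∃ r : ℝ, ‖z - r • v‖ < ε)
    (hS : ∀ x y, (∀ n, p n y = p n x ∧ p n (x + y) = 2 * p n x) → y = x)
    {x : X} (hx : sqSum p hp x = 1) {y : ℕ → X} (hy : ∀ k, sqSum p hp (y k) = 1)
    (hxy : Tendsto (fun k => sqSum p hp (x + y k)) atTop (𝓝 2)) : Tendsto y atTop (𝓝 x) := by
  have hD : Tendsto (fun k => 2 * sqSum p hp x ^ 2 + 2 * sqSum p hp (y k) ^ 2
      - sqSum p hp (x + y k) ^ 2) atTop (𝓝 0) := by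
    simp only [hx, hy]
    convert (hxy.pow 2).const_sub (2 * 1 ^ 2 + 2 * 1 ^ 2) using 2
    norm_num
  have hnn : ∀ n k, 0 ≤ (p n x + p n (y k)) ^ 2 - p n (x + y k) ^ 2 := fun n k => by
    have h1 := map_add_le_add (p n) x (y k)
    have h2 := apply_nonneg (p n) (x + y k)
    nlinarith
  have hA : ∀ n, Tendsto (fun k => p n (y k)) atTop (𝓝 (p n x)) := fun n => by
    have h2 : Tendsto (fun k => (p n x - p n (y k)) ^ 2) atTop (𝓝 0) :=
      squeeze_zero (fun _ => sq_nonneg _)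
        (fun k => by linarith [sqSum_defect hp n x (y k), hnn n k]) hD
    have h3 : Tendsto (fun k => |p n x - p n (y k)|) atTop (𝓝 0) := by
      simpa [Real.sqrt_sq_eq_abs] using h2.sqrt
    rw [tendsto_iff_dist_tendsto_zero]
    simpa [Real.dist_eq, abs_sub_comm] using h3
  have hB : ∀ n, Tendsto (fun k => (p n x + p n (y k)) ^ 2 - p n (x + y k) ^ 2) atTop (𝓝 0) :=
    fun n => squeeze_zero (fun k => hnn n k)
      (fun k => by linarith [sqSum_defect hp n x (y k), sq_nonneg (p n x - p n (y k))]) hD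
  -- By `hA` the tail of `y` inherits the bound `p n x < c` of `hT`, hence stays near a line.
  have hcomp : IsCompact (closure (Set.range y)) := by
    refine TotallyBounded.isCompact_of_isClosed ?_ isClosed_closure
    refine (totallyBounded_range_of_near_line (B := 1) (fun k => (h1 _).trans (hy k).le) ?_).closure
    intro ε hε
    obtain ⟨n, v, c, hn, hc⟩ := hT x ε hε
    refine ⟨v, ?_⟩
    filter_upwards [(hA n).eventually_lt_const hn] with k hk using hc _ hk
  refine tendsto_of_subseq_tendsto fun ns hns => ?_
  obtain ⟨a, -, ms, hms, hlim⟩ := hcomp.tendsto_subseq (x := fun k => y (ns k))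
    (fun k => subset_closure ⟨_, rfl⟩)
  refine ⟨ms, ?_⟩
  have hsub : Tendsto (fun k => ns (ms k)) atTop atTop := hns.comp hms.tendsto_atTop
  have hq : ∀ n z, p n z ≤ C * ‖z‖ := fun n z => (le_sqSum hp n z).trans (hC z)
  -- A cluster point inherits from `hA` and `hB` the equalities required by `hS`.
  have hax : a = x := hS x a fun n => by
    have e1 : p n a = p n x :=
      tendsto_nhds_unique (Seminorm.tendsto_of_le_norm (hq n) hlim) ((hA n).comp hsub)
    refine ⟨e1, ?_⟩
    have e2 := tendsto_nhds_unique (((Seminorm.tendsto_of_le_norm (hq n) hlim).const_add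
      (p n x)).pow 2 |>.sub ((Seminorm.tendsto_of_le_norm (hq n) (hlim.const_add x)).pow 2))
      ((hB n).comp hsub)
    rw [e1] at e2
    have h3 := apply_nonneg (p n) (x + a)
    have h4 := apply_nonneg (p n) x
    nlinarith
  rw [← hax]
  exact hlim

end Kadec

/-! ### The seminorms used as building blocks -/

section Seminorms

variable {X : Type*} [NormedAddCommGroup X] [NormedSpace ℝ X]

/-- The seminorm `x ↦ |g x|`. -/
noncomputable def absSeminorm (g : X →L[ℝ] ℝ) : Seminorm ℝ X := (g : X →ₗ[ℝ] ℝ).toSeminorm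

theorem absSeminorm_apply (g : X →L[ℝ] ℝ) (x : X) : absSeminorm g x = |g x| := rfl

/-- The distance to the line spanned by `v`. -/
noncomputable def lineSeminorm (v : X) : Seminorm ℝ X :=
  (normSeminorm ℝ (X ⧸ Submodule.span ℝ {v})).comp (Submodule.span ℝ {v}).mkQ

theorem lineSeminorm_le_norm_sub (v x : X) : lineSeminorm v x ≤ ‖x - v‖ := by
  have : (Submodule.span ℝ {v}).mkQ x = (Submodule.span ℝ {v}).mkQ (x - v) := by
    rw [map_sub, Submodule.mkQ_apply _ v, (Submodule.Quotient.mk_eq_zero _).2 (Submodule.mem_span_singleton_self v), sub_zero]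
  change ‖(Submodule.span ℝ {v}).mkQ x‖ ≤ _
  rw [this]
  exact Submodule.Quotient.norm_mk_le _ _

theorem lineSeminorm_le_norm (v x : X) : lineSeminorm v x ≤ ‖x‖ :=
  Submodule.Quotient.norm_mk_le _ _

theorem exists_norm_sub_smul_lt {v x : X} {ε : ℝ} (h : lineSeminorm v x < ε) :
    ∃ r : ℝ, ‖x - r • v‖ < ε := by
  change ‖(Submodule.span ℝ {v}).mkQ x‖ < ε at h
  obtain ⟨m, hm, hm'⟩ := Submodule.Quotient.norm_mk_lt ((Submodule.span ℝ {v}).mkQ x)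
    (sub_pos.2 h)
  have : x - m ∈ Submodule.span ℝ {v} := (Submodule.Quotient.eq _).1 (by rw [hm]; rfl)
  obtain ⟨r, hr⟩ := Submodule.mem_span_singleton.1 this
  refine ⟨r, ?_⟩
  rw [hr, sub_sub_cancel]
  linarith

end Seminorms

/-! ### Construction and local uniform convexity of the new norm -/

/-- The data from which the new norm is built. -/
structure PeakSystem (X : Type*) [NormedAddCommGroup X] [NormedSpace ℝ X] (θ : ℝ) where
  /-- the peaks -/
  e : ℕ → X
  /-- the functionals exposing the peaks -/
  φ : ℕ → X →L[ℝ] ℝ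
  /-- a separating sequence of functionals -/
  f : ℕ → X →L[ℝ] ℝ
  /-- a dense sequence -/
  d : ℕ → X
  pos : 0 < θ
  le_one : θ ≤ 1
  norm_e : ∀ n, ‖e n‖ ≤ 1 + θ
  norm_φ : ∀ n, ‖φ n‖ ≤ 1 + θ
  φ_self : ∀ n, φ n (e n) = 1
  φ_lt : ∀ m n, m < n → φ n (e m) = 0
  φ_ne : ∀ m n, m ≠ n → |φ m (e n)| ≤ 1 - θ / 4
  φ_tendsto : ∀ x, Tendsto (fun n => φ n x) atTop (𝓝 0)
  norm_f : ∀ n, ‖f n‖ ≤ 1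
  f_sep : ∀ x, (∀ n, f n x = 0) → x = 0
  dense : DenseRange d

theorem exists_peakSystem {X : Type*} [NormedAddCommGroup X] [NormedSpace ℝ X]
    [TopologicalSpace.SeparableSpace X] (hX : ¬ FiniteDimensional ℝ X) {θ : ℝ} (hθ : 0 < θ)
    (hθ1 : θ ≤ 1) : Nonempty (PeakSystem X θ) := by
  obtain ⟨e, φ, h1, h2, h3, h4, h5, h6⟩ := exists_separated_system hX hθ hθ1
  obtain ⟨f, h7, h8⟩ := exists_separating_sequence (X := X)
  exact ⟨⟨e, φ, f, TopologicalSpace.denseSeq X, hθ, hθ1, h1, h2, h3, h4, h5, h6, h7, h8,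
    TopologicalSpace.denseRange_denseSeq X⟩⟩

namespace PeakSystem

variable {X : Type*} [NormedAddCommGroup X] [NormedSpace ℝ X] {θ : ℝ} (S : PeakSystem X θ)

/-- The functional whose nearest points are to be spread at the `j`-th peak. -/
def slope (j : ℕ) : X →L[ℝ] ℝ := S.f j.unpair.1.unpair.1

/-- The factor by which nearest points are spread at the `j`-th peak. -/
def factor (j : ℕ) : ℝ := j.unpair.1.unpair.2 + 8

/-- The functional along which the norm has a kink at the `j`-th peak. -/
noncomputable def kink (j : ℕ) : X →L[ℝ] ℝ :=
  (factor j)⁻¹ • S.slope j + S.φ (j + 1) - ((factor j)⁻¹ * S.slope j (S.e j)) • S.φ j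

/-- A multiple of `|φ j|`. -/
noncomputable def peak (j : ℕ) : Seminorm ℝ X := absSeminorm ((1 + 2 * θ) • S.φ j)

/-- A multiple of `|φ j|` with a kink along `kink j`. -/
noncomputable def ridge (j : ℕ) : Seminorm ℝ X :=
  S.peak j + absSeminorm (((1 + 2 * θ) * (θ / 112)) • S.kink j)

/-- Runs infinitely often through the distances to the lines spanned by the `d i` and through the
`|f i|`. -/
noncomputable def base (n : ℕ) : Seminorm ℝ X :=
  if Even n.unpair.1 then lineSeminorm (S.d (n.unpair.1 / 2))
  else absSeminorm (S.f (n.unpair.1 / 2))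

theorem eight_le_factor (j : ℕ) : 8 ≤ factor j := by
  unfold factor
  have : (0 : ℝ) ≤ (j.unpair.1.unpair.2 : ℝ) := Nat.cast_nonneg _
  linarith

theorem factor_inv_pos (j : ℕ) : 0 < (factor j)⁻¹ := by
  have := eight_le_factor j
  positivity

theorem factor_inv_le (j : ℕ) : (factor j)⁻¹ ≤ 1 / 8 := by
  rw [one_div]
  exact inv_anti₀ (by norm_num) (eight_le_factor j)

theorem abs_slope_le (j : ℕ) (x : X) : |S.slope j x| ≤ ‖x‖ := by
  simpa using (S.slope j).le_of_opNorm_le (S.norm_f _) x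

theorem abs_φ_le (j : ℕ) (x : X) : |S.φ j x| ≤ (1 + θ) * ‖x‖ :=
  (S.φ j).le_of_opNorm_le (S.norm_φ _) x

theorem kink_apply (j : ℕ) (x : X) : S.kink j x =
    (factor j)⁻¹ * S.slope j x + S.φ (j + 1) x - (factor j)⁻¹ * S.slope j (S.e j) * S.φ j x := rfl

/-- The summand `8` in `factor` is there for this bound. -/
theorem abs_slope_e_le (j i : ℕ) : (factor j)⁻¹ * |S.slope j (S.e i)| ≤ 1 / 4 := by
  have h1 := S.abs_slope_le j (S.e i)
  have h2 := S.norm_e i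
  have h3 := factor_inv_le j
  have h4 := factor_inv_pos j
  have := S.le_one
  calc (factor j)⁻¹ * |S.slope j (S.e i)| ≤ 1 / 8 * 2 := by gcongr; linarith
    _ = 1 / 4 := by norm_num

/-- The multiple of `φ j` in `kink j` is chosen to achieve this: at `t • e j + u` the kink does not
depend on `t`. -/
theorem kink_self (j : ℕ) : S.kink j (S.e j) = 0 := by
  rw [kink_apply, S.φ_self, S.φ_lt _ _ (Nat.lt_succ_self j)]
  ring

/-- The summand `φ (j + 1)` contributes `1`, the other two at most `1/4` each in modulus. So `e (j +
1)` steers the kink at a cost that does not grow with `factor j`. -/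
theorem kink_succ (j : ℕ) : 1 / 2 ≤ S.kink j (S.e (j + 1)) := by
  have h1 := S.abs_slope_e_le j (j + 1)
  have h2 := S.abs_slope_e_le j j
  have h3 := S.φ_ne j (j + 1) (Nat.lt_succ_self j).ne
  have h4 := factor_inv_pos j
  have h5 := S.pos
  rw [kink_apply, S.φ_self]
  have h6 : |(factor j)⁻¹ * S.slope j (S.e (j + 1))| ≤ 1 / 4 := by
    rwa [abs_mul, abs_of_pos h4]
  have h7 : |(factor j)⁻¹ * S.slope j (S.e j) * S.φ j (S.e (j + 1))| ≤ 1 / 4 := by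
    rw [abs_mul, abs_mul, abs_of_pos h4]
    nlinarith [abs_nonneg (S.φ j (S.e (j + 1)))]
  linarith [(abs_le.1 h6).1, (abs_le.1 h7).2]

theorem abs_kink_le (j : ℕ) (x : X) : |S.kink j x| ≤ 7 * ‖x‖ := by
  have h1 := S.abs_slope_le j x
  have h2 := S.abs_slope_e_le j j
  have h3 := S.abs_φ_le j x
  have h3' := S.abs_φ_le (j + 1) x
  have h4 := factor_inv_pos j
  have h5 := S.le_one
  have h6 := factor_inv_le j
  have h0 := norm_nonneg x
  have h8 : |(factor j)⁻¹ * S.slope j x| ≤ ‖x‖ := by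
    rw [abs_mul, abs_of_pos h4]
    nlinarith [abs_nonneg (S.slope j x)]
  have h9 : |(factor j)⁻¹ * S.slope j (S.e j) * S.φ j x| ≤ |S.φ j x| := by
    rw [abs_mul, abs_mul, abs_of_pos h4]
    nlinarith [abs_nonneg (S.φ j x)]
  rw [kink_apply]
  calc _ ≤ |(factor j)⁻¹ * S.slope j x + S.φ (j + 1) x| +
        |(factor j)⁻¹ * S.slope j (S.e j) * S.φ j x| := abs_sub _ _
    _ ≤ |(factor j)⁻¹ * S.slope j x| + |S.φ (j + 1) x| +
        |(factor j)⁻¹ * S.slope j (S.e j) * S.φ j x| := by gcongr; exact abs_add_le _ _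
    _ ≤ _ := by nlinarith

theorem peak_apply (j : ℕ) (x : X) : S.peak j x = (1 + 2 * θ) * |S.φ j x| := by
  change |(1 + 2 * θ) * S.φ j x| = _
  rw [abs_mul, abs_of_pos (by linarith [S.pos])]

theorem ridge_apply (j : ℕ) (x : X) :
    S.ridge j x = (1 + 2 * θ) * (|S.φ j x| + θ / 112 * |S.kink j x|) := by
  change S.peak j x + |((1 + 2 * θ) * (θ / 112)) * S.kink j x| = _
  have := S.pos
  rw [peak_apply, abs_mul, abs_of_pos (show 0 < (1 + 2 * θ) * (θ / 112) by positivity)]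
  ring

theorem peak_le_ridge (j : ℕ) (x : X) : S.peak j x ≤ S.ridge j x := by
  have := S.pos
  rw [peak_apply, ridge_apply]
  have h : 0 ≤ θ / 112 * |S.kink j x| := by positivity
  have h' : 0 ≤ 1 + 2 * θ := by positivity
  exact mul_le_mul_of_nonneg_left (by linarith) h'

theorem ridge_le (j : ℕ) (x : X) : S.ridge j x ≤ (1 + 2 * θ) ^ 2 * ‖x‖ := by
  have h0 := S.pos
  have h1 := S.abs_φ_le j x
  have h2 := S.abs_kink_le j x
  rw [ridge_apply, sq, mul_assoc]
  gcongr
  have : θ / 112 * |S.kink j x| ≤ θ / 112 * (7 * ‖x‖) := by gcongr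
  nlinarith [norm_nonneg x]

theorem sq_le_nine (S : PeakSystem X θ) : (1 + 2 * θ) ^ 2 ≤ 9 := by
  nlinarith [S.pos, S.le_one]

theorem ridge_bdd (x : X) : ∃ C, ∀ j, S.ridge j x ≤ C := ⟨_, fun j => S.ridge_le j x⟩

theorem peak_bdd (x : X) : ∃ C, ∀ j, S.peak j x ≤ C :=
  ⟨_, fun j => (S.peak_le_ridge j x).trans (S.ridge_le j x)⟩

theorem base_le (n : ℕ) (x : X) : S.base n x ≤ ‖x‖ := by
  unfold base
  split_ifs
  · exact lineSeminorm_le_norm _ _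
  · rw [absSeminorm_apply]
    simpa using (S.f (n.unpair.1 / 2)).le_of_opNorm_le (S.norm_f _) x

theorem base_pair_even (i k : ℕ) : S.base (Nat.pair (2 * i) k) = lineSeminorm (S.d i) := by
  simp [base]

theorem base_pair_odd (i k : ℕ) : S.base (Nat.pair (2 * i + 1) k) = absSeminorm (S.f i) := by
  have : (2 * i + 1) / 2 = i := by omega
  simp [base, this]

/-- The main part of the new norm. -/
noncomputable def head : Seminorm ℝ X := tailMax (normSeminorm ℝ X) S.ridge 0

/-- The seminorms that make the new norm locally uniformly convex. -/
noncomputable def layer (n : ℕ) : Seminorm ℝ X := tailMax (S.base n) S.peak n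

theorem norm_le_head (x : X) : ‖x‖ ≤ S.head x := le_tailMax (normSeminorm ℝ X) S.ridge 0 x

theorem head_le (x : X) : S.head x ≤ (1 + 2 * θ) ^ 2 * ‖x‖ :=
  tailMax_le S.ridge_bdd (by
    change ‖x‖ ≤ _
    nlinarith [norm_nonneg x, S.pos, mul_nonneg S.pos.le (norm_nonneg x)]) fun j _ => S.ridge_le j x

theorem layer_le (n : ℕ) (x : X) : S.layer n x ≤ 9 * ‖x‖ :=
  tailMax_le S.peak_bdd ((S.base_le n x).trans (by linarith [norm_nonneg x])) fun j _ =>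
    ((S.peak_le_ridge j x).trans (S.ridge_le j x)).trans (by
      have := S.sq_le_nine
      gcongr)

/-- Only peaks of index at least `n` enter `layer n`, and they tend to zero at `x`. As each base
seminorm recurs infinitely often, the layers recover it in the limit. -/
theorem eventually_layer_le (x : X) {ε : ℝ} (hε : 0 < ε) :
    ∀ᶠ n in atTop, S.layer n x ≤ max (S.base n x) ε := by
  have h1 : Tendsto (fun j => S.peak j x) atTop (𝓝 0) := by
    simp only [peak_apply]
    simpa using (S.φ_tendsto x).abs.const_mul (1 + 2 * θ)
  obtain ⟨m, hm⟩ := eventually_atTop.1 (h1.eventually_le_const hε)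
  filter_upwards [eventually_ge_atTop m] with n hn
  exact tailMax_le S.peak_bdd (le_max_left _ _) fun j hj =>
    (hm j (hn.trans hj)).trans (le_max_right _ _)

variable (θ) in
/-- The weights of the layers. -/
noncomputable def weight (n : ℕ) : ℝ := θ * (1 / 2) ^ (n + 1)

theorem weight_pos (S : PeakSystem X θ) (n : ℕ) : 0 < weight θ n := by
  have := S.pos
  unfold weight
  positivity

theorem hasSum_weight : HasSum (weight θ) θ := by
  have := (hasSum_geometric_two' θ)
  convert this using 1
  funext n
  rw [weight, pow_succ, one_div, inv_pow]
  ring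

/-- The terms of the new norm. -/
noncomputable def term : ℕ → Seminorm ℝ X
  | 0 => S.head
  | n + 1 => (weight θ n).toNNReal • S.layer n

theorem term_succ (n : ℕ) (x : X) : S.term (n + 1) x = weight θ n * S.layer n x := by
  change (weight θ n).toNNReal • S.layer n x = _
  rw [NNReal.smul_def, Real.coe_toNNReal _ (S.weight_pos n).le, smul_eq_mul]

theorem weight_le_one (S : PeakSystem X θ) (n : ℕ) : weight θ n ≤ 1 := by
  have h : ((1 : ℝ) / 2) ^ (n + 1) ≤ 1 := pow_le_one₀ (by norm_num) (by norm_num)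
  unfold weight
  nlinarith [S.pos, S.le_one]

theorem weight_anti (S : PeakSystem X θ) {m n : ℕ} (h : m ≤ n) : weight θ n ≤ weight θ m := by
  unfold weight
  have := S.pos
  have : ((1 : ℝ) / 2) ^ (n + 1) ≤ (1 / 2) ^ (m + 1) :=
    pow_le_pow_of_le_one (by norm_num) (by norm_num) (by omega)
  gcongr

theorem term_succ_sq_le (n : ℕ) (x : X) :
    S.term (n + 1) x ^ 2 ≤ weight θ n * (81 * ‖x‖ ^ 2) := by
  rw [term_succ]
  have h1 := S.layer_le n x
  have h2 := apply_nonneg (S.layer n) x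
  have h3 : S.layer n x ^ 2 ≤ (9 * ‖x‖) ^ 2 := pow_le_pow_left₀ h2 h1 2
  have h4 := S.weight_pos n
  have h5 := S.weight_le_one n
  calc (weight θ n * S.layer n x) ^ 2 = weight θ n * (weight θ n * S.layer n x ^ 2) := by ring
    _ ≤ weight θ n * (1 * (9 * ‖x‖) ^ 2) := by gcongr
    _ = _ := by ring

theorem summable_term_succ (x : X) : Summable fun n => S.term (n + 1) x ^ 2 :=
  Summable.of_nonneg_of_le (fun _ => sq_nonneg _) (fun n => S.term_succ_sq_le n x)
    (hasSum_weight.summable.mul_right _)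

theorem summable_term (x : X) : Summable fun n => S.term n x ^ 2 :=
  (summable_nat_add_iff 1).1 (S.summable_term_succ x)

/-- The new norm. -/
noncomputable def renorm : Seminorm ℝ X := sqSum S.term S.summable_term

theorem renorm_sq (x : X) : S.renorm x ^ 2 = S.head x ^ 2 + ∑' n, S.term (n + 1) x ^ 2 := by
  rw [renorm, sqSum_sq, (S.summable_term x).tsum_eq_zero_add]
  rfl

theorem norm_le_renorm (x : X) : ‖x‖ ≤ S.renorm x :=
  (S.norm_le_head x).trans (le_sqSum S.summable_term 0 x)

/-- `161 = 80 + 81`: for `θ ≤ 1`, `(1 + 2θ)^4 ≤ 1 + 80θ` bounds the head, and the layers add `81θ`.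
-/
theorem renorm_le (x : X) : S.renorm x ≤ (1 + 161 * θ) * ‖x‖ := by
  have h0 := S.pos
  have h1 := S.le_one
  refine le_of_sq_le_sq ?_ (by positivity)
  rw [renorm_sq]
  have h2 : ∑' n, S.term (n + 1) x ^ 2 ≤ θ * (81 * ‖x‖ ^ 2) := by
    refine (Summable.tsum_le_tsum (fun n => S.term_succ_sq_le n x) (S.summable_term_succ x)
      (hasSum_weight.summable.mul_right _)).trans_eq ?_
    rw [tsum_mul_right, hasSum_weight.tsum_eq]
  have h3 : S.head x ^ 2 ≤ ((1 + 2 * θ) ^ 2 * ‖x‖) ^ 2 :=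
    pow_le_pow_left₀ (apply_nonneg _ _) (S.head_le x) 2
  have h4 : (1 + 2 * θ) ^ 4 + 81 * θ ≤ (1 + 161 * θ) ^ 2 := by
    have h5 : θ ^ 2 ≤ θ := by nlinarith
    have h6 : θ ^ 3 ≤ θ := by nlinarith
    have h7 : θ ^ 4 ≤ θ := by nlinarith [sq_nonneg θ]
    nlinarith [sq_nonneg θ]
  nlinarith [mul_le_mul_of_nonneg_right h4 (sq_nonneg ‖x‖)]

/-- In Kadec's criterion the layers over distances to lines give compactness, and those over `|f i|`
identify the limit. -/
theorem tendsto_of_midpoint [CompleteSpace X] {x : X} (hx : S.renorm x = 1) {y : ℕ → X}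
    (hy : ∀ k, S.renorm (y k) = 1)
    (hxy : Tendsto (fun k => S.renorm (x + y k)) atTop (𝓝 2)) : Tendsto y atTop (𝓝 x) := by
  refine sqSum_tendsto_of_midpoint S.summable_term S.renorm_le S.norm_le_renorm ?_ ?_ hx hy hxy
  · intro x ε hε
    obtain ⟨i, hi⟩ := S.dense.exists_dist_lt x hε
    obtain ⟨m, hm⟩ := eventually_atTop.1 (S.eventually_layer_le x (half_pos hε))
    set n := Nat.pair (2 * i) m
    have hbase : S.base n = lineSeminorm (S.d i) := S.base_pair_even i m
    have hw := S.weight_pos n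
    refine ⟨n + 1, S.d i, weight θ n * ε, ?_, fun z hz => ?_⟩
    · rw [term_succ]
      gcongr
      refine (hm n (Nat.right_le_pair _ _)).trans_lt (max_lt ?_ (half_lt_self hε))
      rw [hbase]
      exact (lineSeminorm_le_norm_sub _ _).trans_lt (by rwa [← dist_eq_norm])
    · rw [term_succ] at hz
      have hz' := lt_of_mul_lt_mul_left hz hw.le
      apply exists_norm_sub_smul_lt
      rw [← hbase]
      exact (le_tailMax _ _ _ _).trans_lt hz'
  · intro x y hxy
    have hl : ∀ n, S.layer n y = S.layer n x ∧ S.layer n (x + y) = 2 * S.layer n x := fun n => by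
      obtain ⟨h1, h2⟩ := hxy (n + 1)
      have hw := S.weight_pos n
      simp only [term_succ] at h1 h2
      exact ⟨mul_left_cancel₀ hw.ne' h1, mul_left_cancel₀ hw.ne' (by linarith)⟩
    rw [← sub_eq_zero]
    refine S.f_sep _ fun i => ?_
    have hlim : ∀ z, Tendsto (fun m => S.layer (Nat.pair (2 * i + 1) m) z) atTop (𝓝 |S.f i z|) := by
      intro z
      rw [Metric.tendsto_atTop]
      intro ε hε
      obtain ⟨m, hm⟩ := eventually_atTop.1 (S.eventually_layer_le z (half_pos hε))
      refine ⟨m, fun k hk => ?_⟩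
      have h1 := hm (Nat.pair (2 * i + 1) k) (hk.trans (Nat.right_le_pair _ _))
      have h2 : _ ≤ S.layer (Nat.pair (2 * i + 1) k) z := le_tailMax _ _ _ _
      rw [base_pair_odd, absSeminorm_apply] at h1 h2
      have h3 := h1.trans (max_le_add_of_nonneg (abs_nonneg _) (half_pos hε).le)
      rw [Real.dist_eq, abs_lt]
      constructor <;> linarith
    have e1 : |S.f i y| = |S.f i x| :=
      tendsto_nhds_unique (hlim y) ((hlim x).congr fun m => (hl _).1.symm)
    have e2 : |S.f i (x + y)| = 2 * |S.f i x| :=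
      tendsto_nhds_unique (hlim (x + y)) (((hlim x).const_mul 2).congr fun m => (hl _).2.symm)
    rw [map_add] at e2
    rw [map_sub, sub_eq_zero]
    -- `e1` leaves a sign open; `e2` excludes opposite signs unless both values vanish.
    rcases abs_eq_abs.1 e1 with h | h
    · exact h
    · rw [h, add_neg_cancel, abs_zero] at e2
      have : S.f i x = 0 := abs_eq_zero.1 (by linarith)
      rw [h, this, neg_zero]

end PeakSystem

/-! ### Nearest points far out in the peak directions -/

namespace PeakSystem

variable {X : Type*} [NormedAddCommGroup X] [NormedSpace ℝ X] {θ : ℝ} (S : PeakSystem X θ)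

/-- Far out in the direction of the `j`-th peak, the functional `φ j` dominates. -/
theorem far_estimates (j : ℕ) {D t : ℝ} {u : X} (hu : ‖u‖ ≤ D) (ht : 40 * D < θ * t) :
    0 ≤ t + S.φ j u ∧ t / 2 ≤ t + S.φ j u ∧ ‖t • S.e j + u‖ ≤ 3 * t ∧
      ‖t • S.e j + u‖ ≤ S.peak j (t • S.e j + u) ∧
      ∀ i, i ≠ j → S.ridge i (t • S.e j + u) ≤ S.peak j (t • S.e j + u) := by
  have hθ := S.pos
  have hθ1 := S.le_one
  have hD : 0 ≤ D := (norm_nonneg u).trans hu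
  have ht0 : 0 < t := by
    by_contra h
    nlinarith
  have htD : 40 * D ≤ t := by nlinarith
  have hφ : ∀ i, |S.φ i u| ≤ 2 * D := fun i =>
    (S.abs_φ_le i u).trans (by nlinarith [norm_nonneg u])
  have hφj := abs_le.1 (hφ j)
  have happ : S.φ j (t • S.e j + u) = t + S.φ j u := by
    rw [map_add, map_smul, S.φ_self, smul_eq_mul, mul_one]
  have hpos : 0 ≤ t + S.φ j u := by linarith
  have hnorm : ‖t • S.e j + u‖ ≤ (1 + θ) * t + D := by
    refine (norm_add_le _ _).trans (add_le_add ?_ hu)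
    rw [norm_smul, Real.norm_of_nonneg ht0.le]
    nlinarith [S.norm_e j]
  refine ⟨hpos, by linarith, by nlinarith, ?_, fun i hi => ?_⟩
  · rw [peak_apply, happ, abs_of_nonneg hpos]
    nlinarith
  · rw [peak_apply, ridge_apply, happ, abs_of_nonneg hpos]
    refine mul_le_mul_of_nonneg_left ?_ (by positivity)
    have h1 : |S.φ i (t • S.e j + u)| ≤ (1 - θ / 4) * t + 2 * D := by
      rw [map_add, map_smul, smul_eq_mul]
      refine (abs_add_le _ _).trans (add_le_add ?_ (hφ i))
      rw [abs_mul, abs_of_pos ht0]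
      nlinarith [S.φ_ne i j hi]
    -- The factor `θ/112` turns `14 * t` into `θ t/8`, half of the gap `θ t/4` provided by `φ_ne`.
    -- The other half absorbs the multiples of `D`.
    have h2 : |S.kink i (t • S.e j + u)| ≤ 14 * t + 7 * D :=
      (S.abs_kink_le i _).trans (by nlinarith)
    have h3 : θ / 112 * |S.kink i (t • S.e j + u)| ≤ θ / 112 * (14 * t + 7 * D) := by gcongr
    nlinarith

theorem layer_eq (j : ℕ) {D t : ℝ} {u : X} (hu : ‖u‖ ≤ D) (ht : 40 * D < θ * t) {n : ℕ}
    (hn : n ≤ j) : S.layer n (t • S.e j + u) = (1 + 2 * θ) * (t + S.φ j u) := by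
  obtain ⟨h1, -, -, h4, h5⟩ := S.far_estimates j hu ht
  rw [layer, tailMax_eq S.peak_bdd hn ((S.base_le _ _).trans h4)
    fun i hi => (S.peak_le_ridge _ _).trans (h5 i hi), peak_apply, map_add, map_smul, S.φ_self,
    smul_eq_mul, mul_one, abs_of_nonneg h1]

theorem head_eq (j : ℕ) {D t : ℝ} {u : X} (hu : ‖u‖ ≤ D) (ht : 40 * D < θ * t) :
    S.head (t • S.e j + u) = (1 + 2 * θ) * (t + S.φ j u + θ / 112 * |S.kink j u|) := by
  obtain ⟨h1, -, -, h4, h5⟩ := S.far_estimates j hu ht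
  rw [head, tailMax_eq S.ridge_bdd (Nat.zero_le j) (h4.trans (S.peak_le_ridge _ _))
    fun i hi => (h5 i hi).trans (S.peak_le_ridge _ _), ridge_apply, map_add, map_smul, S.φ_self,
    smul_eq_mul, mul_one, abs_of_nonneg h1, map_add, map_smul, S.kink_self, smul_zero, zero_add]

variable (θ) in
/-- The constant in the estimate of the nearest point to a point far out in a peak direction. -/
noncomputable def spread (B : ℝ) : ℝ := 4 + (54 * (6 + 18 * B) + 2) / (θ / 112)

theorem spread_pos (S : PeakSystem X θ) {B : ℝ} (hB : 0 ≤ B) : 0 < spread θ B := by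
  have := S.pos
  unfold spread
  positivity

/-- The variation over `K` of the layers is negligible far out in the direction of a peak. -/
theorem term_sq_sub_le (j : ℕ) {D t B η : ℝ} {v k k' : X} (hη : 0 ≤ η)
    (hu : ‖v - k‖ ≤ D) (hu' : ‖v - k'‖ ≤ D) (ht : 40 * D < θ * t) (hk : ‖k‖ ≤ B) (hk' : ‖k'‖ ≤ B)
    (hφ : |S.φ j k| ≤ η) (hφ' : |S.φ j k'| ≤ η) (hw : weight θ j ≤ η) (n : ℕ) :
    S.term (n + 1) (t • S.e j + (v - k')) ^ 2 ≤ S.term (n + 1) (t • S.e j + (v - k)) ^ 2 +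
      weight θ n * (54 * (6 + 18 * B) * (t * η)) := by
  have hθ1 := S.le_one
  have hB : 0 ≤ B := (norm_nonneg k).trans hk
  have hD : 0 ≤ D := (norm_nonneg _).trans hu
  have ht0 : 0 < t := by
    by_contra h
    nlinarith [S.pos]
  obtain ⟨-, -, h3, -, -⟩ := S.far_estimates j hu ht
  obtain ⟨-, -, h3', -, -⟩ := S.far_estimates j hu' ht
  rw [term_succ, term_succ]
  set y := t • S.e j + (v - k) with hy
  set y' := t • S.e j + (v - k') with hy'
  have hw0 := S.weight_pos n
  have hw1 := S.weight_le_one n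
  have hq0 := apply_nonneg (S.layer n) y
  have hq0' := apply_nonneg (S.layer n) y'
  have hq : S.layer n y ≤ 27 * t := (S.layer_le n y).trans (by linarith)
  have hq' : S.layer n y' ≤ 27 * t := (S.layer_le n y').trans (by linarith)
  have hdiff : weight θ n * (S.layer n y' - S.layer n y) ≤ (6 + 18 * B) * η := by
    -- Up to `j` the layer is affine in `φ j`, which is at most `η` at `k` and `k'`. Beyond `j` the
    -- weight is at most `η`, and the layer varies by at most `9 * 2B`.
    by_cases hn : n ≤ j
    · rw [hy, hy', S.layer_eq j hu ht hn, S.layer_eq j hu' ht hn]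
      simp only [map_sub]
      have := abs_le.1 hφ
      have := abs_le.1 hφ'
      have h6 : (1 + 2 * θ) * (t + (S.φ j v - S.φ j k')) - (1 + 2 * θ) * (t + (S.φ j v - S.φ j k))
          ≤ 6 * η := by nlinarith [S.pos]
      nlinarith [mul_nonneg hB hη]
    · have hww : weight θ n ≤ η := (S.weight_anti (le_of_not_ge hn)).trans hw
      have h7 : S.layer n y' - S.layer n y ≤ 18 * B := by
        refine ((le_abs_self _).trans (abs_sub_map_le_sub (S.layer n) y' y)).trans ((S.layer_le n _).trans ?_)
        have h8 : y' - y = k - k' := by rw [hy, hy']; abel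
        rw [h8]
        linarith [norm_sub_le k k']
      nlinarith [mul_nonneg hB hη]
  have hsum : 0 ≤ S.layer n y' + S.layer n y := by linarith
  have hsum' : S.layer n y' + S.layer n y ≤ 54 * t := by linarith
  have hR : 0 ≤ (6 + 18 * B) * η := by positivity
  have h9 : weight θ n * (S.layer n y' - S.layer n y) * (S.layer n y' + S.layer n y) ≤
      (6 + 18 * B) * η * (54 * t) :=
    (mul_le_mul_of_nonneg_right hdiff hsum).trans (mul_le_mul_of_nonneg_left hsum' hR)
  nlinarith [mul_le_mul_of_nonneg_left h9 hw0.le]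

/-- Where `φ j` and `φ (j + 1)` are small, only the `slope j` summand of the kink survives. -/
theorem abs_kink_sub_le (j : ℕ) {η : ℝ} {v k z : X}
    (hv : S.kink j v = (factor j)⁻¹ * S.slope j k) (hz : |S.φ j z| ≤ η)
    (hz' : |S.φ (j + 1) z| ≤ η) :
    |S.kink j (v - z) - (factor j)⁻¹ * (S.slope j k - S.slope j z)| ≤ 2 * η := by
  have h1 := S.abs_slope_e_le j j
  have h3 : |(factor j)⁻¹ * S.slope j (S.e j) * S.φ j z| ≤ 1 * η := by
    rw [abs_mul, abs_mul, abs_of_pos (factor_inv_pos j)]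
    exact mul_le_mul (by linarith) hz (abs_nonneg _) zero_le_one
  have h4 : S.kink j (v - z) - (factor j)⁻¹ * (S.slope j k - S.slope j z) =
      (factor j)⁻¹ * S.slope j (S.e j) * S.φ j z - S.φ (j + 1) z := by
    rw [map_sub, hv, kink_apply]
    ring
  rw [h4]
  exact (abs_sub _ _).trans (by linarith)

/-- Far out in the direction of a peak, the value of `slope j` at the nearest point is governed by
`kink j`. -/
theorem abs_slope_sub_le (j : ℕ) {D t B η : ℝ} {v k k' : X} (hη : 0 ≤ η)
    (hu : ‖v - k‖ ≤ D) (hu' : ‖v - k'‖ ≤ D) (ht : 40 * D < θ * t) (hk : ‖k‖ ≤ B) (hk' : ‖k'‖ ≤ B)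
    (hφ : |S.φ j k| ≤ η) (hφ' : |S.φ j k'| ≤ η) (hψ : |S.φ (j + 1) k| ≤ η)
    (hψ' : |S.φ (j + 1) k'| ≤ η) (hw : weight θ j ≤ η)
    (hv : S.kink j v = (factor j)⁻¹ * S.slope j k')
    (hle : S.renorm (t • S.e j + (v - k)) ≤ S.renorm (t • S.e j + (v - k'))) :
    |S.slope j k - S.slope j k'| ≤ factor j * η * spread θ B := by
  have hθ := S.pos
  have hθ1 := S.le_one
  have hB : 0 ≤ B := (norm_nonneg k).trans hk
  have hD : 0 ≤ D := (norm_nonneg _).trans hu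
  have ht0 : 0 < t := by
    by_contra h
    nlinarith
  set L : ℝ := 54 * (6 + 18 * B) with hL
  have hL0 : 0 ≤ L := by positivity
  have hsum : ∑' n, S.term (n + 1) (t • S.e j + (v - k')) ^ 2 ≤
      ∑' n, S.term (n + 1) (t • S.e j + (v - k)) ^ 2 + θ * (L * (t * η)) := by
    have hs := (hasSum_weight (θ := θ)).mul_right (L * (t * η))
    rw [← hs.tsum_eq, ← (S.summable_term_succ _).tsum_add hs.summable]
    exact Summable.tsum_le_tsum
      (fun n => S.term_sq_sub_le j hη hu hu' ht hk hk' hφ hφ' hw n)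
      (S.summable_term_succ _) ((S.summable_term_succ _).add hs.summable)
  have hsq := pow_le_pow_left₀ (apply_nonneg S.renorm _) hle 2
  rw [renorm_sq, renorm_sq] at hsq
  obtain ⟨-, h2, -, -, -⟩ := S.far_estimates j hu ht
  obtain ⟨-, h2', -, -, -⟩ := S.far_estimates j hu' ht
  have hp := S.head_eq j hu ht
  have hp' := S.head_eq j hu' ht
  set P := S.head (t • S.e j + (v - k))
  set P' := S.head (t • S.e j + (v - k'))
  set G := |S.kink j (v - k)| with hG
  set G' := |S.kink j (v - k')| with hG'
  have hG0 : 0 ≤ θ / 112 * G := by positivity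
  have hG0' : 0 ≤ θ / 112 * G' := by positivity
  have hPt : t / 2 ≤ P := by
    rw [hp]
    nlinarith
  have hPt' : t / 2 ≤ P' := by
    rw [hp']
    nlinarith
  have hPP : P ^ 2 ≤ P' ^ 2 + t * (L * η) := by
    have : θ * (L * (t * η)) ≤ 1 * (L * (t * η)) := by gcongr
    linarith
  -- The error in the squares is of order `t η`, and `P + P' ≥ t`; dividing removes `t`, so the
  -- distance to the peak costs nothing.
  have hdiff : P - P' ≤ L * η := by
    by_contra! h
    have hpos : 0 ≤ L * η := by positivity
    have h1 : L * η * t < (P - P') * t := mul_lt_mul_of_pos_right h ht0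
    have h3 : (P - P') * t ≤ (P - P') * (P + P') :=
      mul_le_mul_of_nonneg_left (by linarith) (hpos.trans h.le)
    linarith
  have hφv : S.φ j (v - k) = S.φ j v - S.φ j k := map_sub _ _ _
  have hφv' : S.φ j (v - k') = S.φ j v - S.φ j k' := map_sub _ _ _
  have hφa := abs_le.1 hφ
  have hφa' := abs_le.1 hφ'
  have hGG : θ / 112 * (G - G') ≤ (L + 2) * η := by
    have h1 : P - P' = (1 + 2 * θ) * (S.φ j k' - S.φ j k + θ / 112 * (G - G')) := by
      rw [hp, hp', hφv, hφv']
      ring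
    rw [h1] at hdiff
    by_contra! h
    have h3 := mul_nonneg hL0 hη
    have h4 : L * η < S.φ j k' - S.φ j k + θ / 112 * (G - G') := by linarith
    have h5 := mul_nonneg hθ.le (h3.trans h4.le)
    linarith
  have hf := factor_inv_pos j
  have hf8 := factor_inv_le j
  have hk1 := S.abs_kink_sub_le j hv hφ hψ
  have hk2 := S.abs_kink_sub_le j hv hφ' hψ'
  -- By the choice of `v` the main term vanishes at `k'`, so `G' ≤ 2η`.
  rw [sub_self, mul_zero, sub_zero] at hk2
  have hk3 : (factor j)⁻¹ * |S.slope j k - S.slope j k'| ≤ G + 2 * η := by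
    have := abs_sub_abs_le_abs_sub ((factor j)⁻¹ * (S.slope j k' - S.slope j k)) (S.kink j (v - k))
    rw [abs_sub_comm _ (S.kink j (v - k)), abs_mul, abs_of_pos hf, abs_sub_comm] at this
    linarith
  have hG4 : G - G' ≤ (L + 2) / (θ / 112) * η := by
    rw [div_mul_eq_mul_div, le_div_iff₀ (by positivity)]
    linarith
  have hfin : (factor j)⁻¹ * |S.slope j k - S.slope j k'| ≤ η * spread θ B := by
    unfold spread
    rw [← hL]
    linarith
  rw [inv_mul_le_iff₀ (by linarith [eight_le_factor j])] at hfin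
  linarith

/-- The outer second coordinate is padding that makes `j` large. -/
theorem exists_index (i m N : ℕ) : ∃ j, N ≤ j ∧ S.slope j = S.f i ∧ factor j = m + 8 :=
  ⟨Nat.pair (Nat.pair i m) N, Nat.right_le_pair _ _, by simp [slope], by simp [factor]⟩

theorem eventually_abs_φ_le {K : Set X} (hK : IsCompact K) {η : ℝ} (hη : 0 < η) :
    ∀ᶠ n in atTop, ∀ k ∈ K, |S.φ n k| ≤ η := by
  obtain ⟨t, ht, hKt⟩ := Metric.totallyBounded_iff.1 hK.totallyBounded (η / 4) (by positivity)
  have h : ∀ᶠ n in atTop, ∀ z ∈ t, |S.φ n z| < η / 2 :=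
    (ht.eventually_all).2 fun z _ => by
      have := (S.φ_tendsto z).abs
      rw [abs_zero] at this
      exact this.eventually_lt_const (half_pos hη)
  filter_upwards [h] with n hn k hk
  obtain ⟨z, hz, hkz⟩ := Set.mem_iUnion₂.1 (hKt hk)
  rw [Metric.mem_ball, dist_eq_norm] at hkz
  have h1 := S.abs_φ_le n (k - z)
  have h2 := hn z hz
  have h3 : S.φ n k = S.φ n (k - z) + S.φ n z := by rw [← map_add, sub_add_cancel]
  rw [h3]
  refine (abs_add_le _ _).trans ?_
  nlinarith [S.le_one, norm_nonneg (k - z), S.pos]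

/-- For the new norm, nearest point maps onto nontrivial compact sets are not uniformly
continuous. -/
theorem not_uniform {K : Set X} (hK : IsCompact K) (hK2 : K.Nontrivial) {R : X → X}
    (hR : ∀ x, R x ∈ K) (hRle : ∀ x, ∀ k ∈ K, S.renorm (x - R x) ≤ S.renorm (x - k)) :
    ∃ ε > 0, ∀ δ > 0, ∃ x y, S.renorm (x - y) < δ ∧ ε ≤ S.renorm (R x - R y) := by
  obtain ⟨k₁, hk₁, k₂, hk₂, hne⟩ := hK2
  obtain ⟨i, hi⟩ : ∃ i, S.f i (k₁ - k₂) ≠ 0 := by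
    by_contra! h
    exact hne (sub_eq_zero.1 (S.f_sep _ h))
  have hθ := S.pos
  have hθ1 := S.le_one
  set Δ := |S.f i (k₁ - k₂)|
  have hΔ : 0 < Δ := abs_pos.2 hi
  refine ⟨Δ / 2, half_pos hΔ, fun δ hδ => ?_⟩
  obtain ⟨B, hB⟩ := hK.isBounded.exists_norm_le
  have hB0 : 0 ≤ B := (norm_nonneg _).trans (hB k₁ hk₁)
  have hC := S.spread_pos hB0
  -- `M` depends on `δ`, then `η` on `M`, then `j` on `η`. Here `162` bounds the new norm by the old
  -- one, and `4` bounds `‖e (j + 1)‖ / γ`.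
  obtain ⟨m, hm⟩ := exists_nat_gt (162 * (4 * Δ) / δ)
  set M : ℝ := m + 8 with hM
  have hM0 : 0 < M := by positivity
  -- This makes each of the two errors `Δ/5`, leaving a gap of `3Δ/5 > Δ/2`.
  set η := Δ / (5 * M * spread θ B) with hη
  have hη0 : 0 < η := by positivity
  have hw : ∀ᶠ j in atTop, weight θ j ≤ η :=
    (hasSum_weight.summable.tendsto_atTop_zero).eventually_le_const hη0
  have hφ := S.eventually_abs_φ_le hK hη0
  obtain ⟨N, hN⟩ := eventually_atTop.1 (hw.and hφ)
  obtain ⟨j, hj, hslope, hfac⟩ := S.exists_index i m N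
  have hφj := (hN j hj).2
  have hφj' := (hN (j + 1) (by omega)).2
  have hwj := (hN j hj).1
  rw [← hM] at hfac
  set γ := S.kink j (S.e (j + 1)) with hγ
  have hγ1 : 1 / 2 ≤ γ := S.kink_succ j
  have hγ0 : 0 < γ := by linarith
  let v : X → X := fun k => (M⁻¹ * S.f i k / γ) • S.e (j + 1)
  have hv : ∀ k, S.kink j (v k) = (factor j)⁻¹ * S.slope j k := fun k => by
    rw [map_smul, smul_eq_mul, ← hγ, div_mul_cancel₀ _ hγ0.ne', hfac, hslope]
  set D := ‖v k₁‖ + ‖v k₂‖ + B with hD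
  have hD0 : 0 ≤ D := by positivity
  set t := (40 * D + 1) / θ with ht'
  have ht : 40 * D < θ * t := by
    rw [ht', mul_div_cancel₀ _ hθ.ne']
    linarith
  have hclose : ∀ k ∈ K, ‖v k‖ ≤ ‖v k₁‖ + ‖v k₂‖ →
      |S.f i (R (t • S.e j + v k)) - S.f i k| ≤ Δ / 5 := by
    intro k hk hvk
    have hu : ∀ z ∈ K, ‖v k - z‖ ≤ D := fun z hz =>
      (norm_sub_le _ _).trans (by linarith [hB z hz])
    have hRk := hR (t • S.e j + v k)
    have := S.abs_slope_sub_le j hη0.le (hu _ hRk) (hu _ hk) ht (hB _ hRk) (hB _ hk)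
      (hφj _ hRk) (hφj _ hk) (hφj' _ hRk) (hφj' _ hk) hwj (hv k) (by
        rw [← add_sub_assoc, ← add_sub_assoc]
        exact hRle _ k hk)
    rw [hslope, hfac] at this
    refine this.trans_eq ?_
    rw [hη]
    field_simp
  have h1 := abs_le.1 (hclose k₁ hk₁ (by linarith [norm_nonneg (v k₂)]))
  have h2 := abs_le.1 (hclose k₂ hk₂ (by linarith [norm_nonneg (v k₁)]))
  refine ⟨t • S.e j + v k₁, t • S.e j + v k₂, ?_, ?_⟩
  · have h3 : t • S.e j + v k₁ - (t • S.e j + v k₂) =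
        (M⁻¹ * S.f i (k₁ - k₂) / γ) • S.e (j + 1) := by
      rw [add_sub_add_left_eq_sub, ← sub_smul, map_sub]
      congr 1
      ring
    have h4 : ‖(M⁻¹ * S.f i (k₁ - k₂) / γ) • S.e (j + 1)‖ ≤ M⁻¹ * (4 * Δ) := by
      rw [norm_smul, norm_div, norm_mul, norm_inv, Real.norm_of_nonneg hM0.le,
        Real.norm_of_nonneg hγ0.le, Real.norm_eq_abs, div_mul_eq_mul_div, div_le_iff₀ hγ0]
      have h5 : 0 ≤ M⁻¹ * Δ := by positivity
      calc M⁻¹ * Δ * ‖S.e (j + 1)‖ ≤ M⁻¹ * Δ * 2 := by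
            gcongr
            linarith [S.norm_e (j + 1)]
        _ ≤ M⁻¹ * (4 * Δ) * γ := by nlinarith
    rw [h3]
    calc _ ≤ (1 + 161 * θ) * ‖(M⁻¹ * S.f i (k₁ - k₂) / γ) • S.e (j + 1)‖ := S.renorm_le _
      _ ≤ 162 * (M⁻¹ * (4 * Δ)) := by gcongr; linarith
      _ < δ := by
        have h6 : 162 * (4 * Δ) / δ < M := by rw [hM]; linarith
        rw [div_lt_iff₀ hδ] at h6
        rw [mul_left_comm, inv_mul_lt_iff₀ hM0]
        exact h6
  · refine le_trans ?_ (S.norm_le_renorm _)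
    have h7 := (S.f i).le_of_opNorm_le (S.norm_f i)
      (R (t • S.e j + v k₁) - R (t • S.e j + v k₂))
    rw [one_mul, Real.norm_eq_abs, map_sub] at h7
    refine le_trans ?_ h7
    have h8 : Δ ≤ |S.f i (R (t • S.e j + v k₁)) - S.f i (R (t • S.e j + v k₂))| + 2 * (Δ / 5) := by
      have h9 : Δ = |S.f i k₁ - S.f i k₂| := by rw [← map_sub]
      rw [h9] at h1 h2 ⊢
      have h10 := abs_nonneg (S.f i k₁ - S.f i k₂)
      have h11 := neg_abs_le (S.f i (R (t • S.e j + v k₁)) - S.f i (R (t • S.e j + v k₂)))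
      have h12 := le_abs_self (S.f i (R (t • S.e j + v k₁)) - S.f i (R (t • S.e j + v k₂)))
      rw [← sub_le_iff_le_add]
      rcases abs_cases (S.f i k₁ - S.f i k₂) with ⟨h, -⟩ | ⟨h, -⟩ <;> rw [h] at h1 h2 ⊢ <;> linarith
    linarith

end PeakSystem

/-! ### Nearest point maps in strictly convex spaces -/

section NearestPoints

variable {Y : Type*} [NormedAddCommGroup Y] [NormedSpace ℝ Y]

theorem LocallyUniformlyConvex.strictConvexSpace (h : LocallyUniformlyConvex Y) :
    StrictConvexSpace ℝ Y := by
  refine StrictConvexSpace.of_norm_add_ne_two fun x y hx hy hne h2 => hne ?_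
  have h1 : ‖(1 / 2 : ℝ) • (x + y)‖ = 1 := by
    rw [norm_smul, h2]
    norm_num
  have := h x hx (fun _ => y) (fun _ => hy) (by rw [h1]; exact tendsto_const_nhds)
  exact sub_eq_zero.1 (norm_eq_zero.1 (tendsto_nhds_unique tendsto_const_nhds this))

theorem eq_of_dist_eq_infDist [StrictConvexSpace ℝ Y] {K : Set Y} (hK : Convex ℝ K) {x k k' : Y}
    (hk : k ∈ K) (hk' : k' ∈ K) (h : dist x k = Metric.infDist x K)
    (h' : dist x k' = Metric.infDist x K) : k = k' := by
  by_contra hne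
  rw [dist_eq_norm] at h h'
  have h1 := norm_combo_lt_of_ne (a := 1 / 2) (b := 1 / 2) h.le h'.le
    (fun h => hne (sub_right_injective h)) (by norm_num) (by norm_num) (by norm_num)
  have h2 : (1 / 2 : ℝ) • k + (1 / 2 : ℝ) • k' ∈ K :=
    hK hk hk' (by norm_num) (by norm_num) (by norm_num)
  have h3 := Metric.infDist_le_dist_of_mem (x := x) h2
  rw [dist_eq_norm] at h3
  have h4 : x - ((1 / 2 : ℝ) • k + (1 / 2 : ℝ) • k') =
      (1 / 2 : ℝ) • (x - k) + (1 / 2 : ℝ) • (x - k') := by module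
  rw [h4] at h3
  exact h1.not_ge h3

theorem IsNearestPointMap.continuous [StrictConvexSpace ℝ Y] {K : Set Y} (hK : IsCompact K)
    (hc : Convex ℝ K) {R : Y → K} (hR : IsNearestPointMap K R) : Continuous R := by
  have := isCompact_iff_compactSpace.1 hK
  rw [continuous_iff_seqContinuous]
  intro u x hu
  refine tendsto_of_subseq_tendsto fun ns hns => ?_
  obtain ⟨k, ms, hms, hlim⟩ := CompactSpace.tendsto_subseq fun n => R (u (ns n))
  refine ⟨ms, ?_⟩
  have hu' : Tendsto (fun n => u (ns (ms n))) atTop (𝓝 x) :=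
    hu.comp (hns.comp hms.tendsto_atTop)
  have h1 : Tendsto (fun n => dist (u (ns (ms n))) (R (u (ns (ms n))) : Y)) atTop
      (𝓝 (dist x (k : Y))) := hu'.dist ((continuous_subtype_val.tendsto k).comp hlim)
  have h2 : Tendsto (fun n => dist (u (ns (ms n))) (R (u (ns (ms n))) : Y)) atTop
      (𝓝 (Metric.infDist x K)) := by
    simp only [hR _]
    exact ((Metric.continuous_infDist_pt K).tendsto x).comp hu'
  have hk : R x = k := Subtype.ext (eq_of_dist_eq_infDist hc (R x).2 k.2 (hR x)
    (tendsto_nhds_unique h1 h2))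
  rw [hk]
  exact hlim

theorem nearestPointMapsNotUniform_of_forall [StrictConvexSpace ℝ Y]
    (h : ∀ K : Set Y, IsCompact K → K.Nontrivial → ∀ R : Y → K, IsNearestPointMap K R →
      ¬ UniformContinuous R) : NearestPointMapsNotUniform Y := by
  intro K hK hc hn
  choose r hr hrd using hK.exists_infDist_eq_dist hn.nonempty
  have hR : IsNearestPointMap K fun x => (⟨r x, hr x⟩ : K) := fun x => (hrd x).symm
  exact ⟨_, hR, fun R' hR' => funext fun x =>
    Subtype.ext (eq_of_dist_eq_infDist hc (R' x).2 (hr x) (hR' x) (hR x)),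
    hR.continuous hK hc, h K hK hn _ hR⟩

end NearestPoints

/-! ### Passage to the renormed space -/

section Renorming

/-- `E` has only its algebraic structure here, so the new norm does not clash with an existing one.
-/
theorem exists_normedSpace_of_seminorm {E : Type u} [AddCommGroup E] [Module ℝ E]
    (N : Seminorm ℝ E) (hN : ∀ x, N x = 0 → x = 0) :
    ∃ (Y : Type u) (_ : NormedAddCommGroup Y) (_ : NormedSpace ℝ Y) (L : E ≃ₗ[ℝ] Y),
      ∀ x, ‖L x‖ = N x := by
  let _ : NormedAddCommGroup E := AddGroupNorm.toNormedAddCommGroup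
    { N.toAddGroupSeminorm with eq_zero_of_map_eq_zero' := hN }
  let _ : NormedSpace ℝ E := ⟨fun a x => (map_smul_eq_mul N a x).le⟩
  exact ⟨E, inferInstance, inferInstance, LinearEquiv.refl ℝ E, fun _ => rfl⟩

variable {X : Type*} [NormedAddCommGroup X] [NormedSpace ℝ X] {θ : ℝ} (S : PeakSystem X θ)
  {Y : Type*} [NormedAddCommGroup Y] [NormedSpace ℝ Y]

theorem PeakSystem.locallyUniformlyConvex [CompleteSpace X] (T : X ≃L[ℝ] Y)
    (hT : ∀ x, ‖T x‖ = S.renorm x) : LocallyUniformlyConvex Y := by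
  intro x hx y hy hxy
  have hN : ∀ z, S.renorm (T.symm z) = ‖z‖ := fun z => by rw [← hT, T.apply_symm_apply]
  have h2 : Tendsto (fun k => S.renorm (T.symm x + T.symm (y k))) atTop (𝓝 2) := by
    convert hxy.const_mul 2 using 2 with k
    · rw [← map_add, hN, norm_smul, Real.norm_of_nonneg (by norm_num)]
      ring
    · norm_num
  have h3 := S.tendsto_of_midpoint ((hN x).trans hx) (fun k => (hN _).trans (hy k)) h2
  have h4 : Tendsto y atTop (𝓝 x) := by
    simpa [Function.comp_def] using (T.continuous.tendsto _).comp h3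
  simpa using (h4.const_sub x).norm

theorem PeakSystem.nearestPointMapsNotUniform [StrictConvexSpace ℝ Y] (T : X ≃L[ℝ] Y)
    (hT : ∀ x, ‖T x‖ = S.renorm x) : NearestPointMapsNotUniform Y := by
  refine nearestPointMapsNotUniform_of_forall fun K hK hn R hR hu => ?_
  have hmem : ∀ x, T.symm (R (T x)) ∈ T.symm '' K := fun x => ⟨_, (R (T x)).2, rfl⟩
  obtain ⟨ε, hε, h⟩ := S.not_uniform (hK.image T.symm.continuous) (hn.image T.symm.injective)
    hmem (by
      rintro x _ ⟨k, hk, rfl⟩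
      rw [← hT, ← hT, map_sub, map_sub, T.apply_symm_apply, T.apply_symm_apply, ← dist_eq_norm,
        ← dist_eq_norm, hR]
      exact Metric.infDist_le_dist_of_mem hk)
  obtain ⟨δ, hδ, hδε⟩ := Metric.uniformContinuous_iff.1 hu ε hε
  obtain ⟨x, y, hxy, hxy'⟩ := h δ hδ
  rw [← hT, map_sub, ← dist_eq_norm] at hxy
  rw [← hT, map_sub, T.apply_symm_apply, T.apply_symm_apply, ← dist_eq_norm] at hxy'
  exact (hδε hxy).not_ge hxy'

theorem exists_renorming {ε : ℝ} (hε : 0 < ε) (X : Type u) [NormedAddCommGroup X]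
    [NormedSpace ℝ X] [CompleteSpace X] [TopologicalSpace.SeparableSpace X]
    (hX : ¬ FiniteDimensional ℝ X) :
    ∃ (Y : Type u) (_ : NormedAddCommGroup Y) (_ : NormedSpace ℝ Y),
      CompleteSpace Y ∧ TopologicalSpace.SeparableSpace Y ∧
      LocallyUniformlyConvex Y ∧ NearestPointMapsNotUniform Y ∧
      IsomorphicWithConstant (1 + ε) X Y := by
  set θ : ℝ := min 1 (ε / 161) with hθ
  have hθ0 : 0 < θ := lt_min one_pos (by positivity)
  obtain ⟨S⟩ := exists_peakSystem hX hθ0 (min_le_left _ _)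
  obtain ⟨Y, i1, i2, L, hL⟩ := exists_normedSpace_of_seminorm S.renorm fun x hx =>
    norm_le_zero_iff.1 (hx ▸ S.norm_le_renorm x)
  have h1 : ∀ x, ‖L x‖ ≤ (1 + ε) * ‖x‖ := fun x => by
    have : θ ≤ ε / 161 := min_le_right _ _
    rw [hL]
    refine (S.renorm_le x).trans ?_
    gcongr
    linarith
  have h2 : ∀ y, ‖L.symm y‖ ≤ 1 * ‖y‖ := fun y => by
    have := S.norm_le_renorm (L.symm y)
    rwa [← hL, L.apply_symm_apply, ← one_mul ‖y‖] at this
  let T : X ≃L[ℝ] Y := L.toContinuousLinearEquivOfBounds (1 + ε) 1 h1 h2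
  have hT : ∀ x, ‖T x‖ = S.renorm x := hL
  have hluc := S.locallyUniformlyConvex T hT
  have := hluc.strictConvexSpace
  refine ⟨Y, i1, i2, (completeSpace_congr (e := T.toEquiv) T.isUniformEmbedding).1 inferInstance,
    T.surjective.denseRange.separableSpace T.continuous, hluc,
    S.nearestPointMapsNotUniform T hT, T, ?_⟩
  have h3 : ‖(T : X →L[ℝ] Y)‖ ≤ 1 + ε :=
    ContinuousLinearMap.opNorm_le_bound _ (by positivity) h1
  have h4 : ‖(T.symm : Y →L[ℝ] X)‖ ≤ 1 := ContinuousLinearMap.opNorm_le_bound _ zero_le_one h2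
  calc _ ≤ (1 + ε) * 1 := mul_le_mul h3 h4 (norm_nonneg _) (by positivity)
    _ = 1 + ε := mul_one _

end Renorming

/-! ### Existence of an example and conclusion -/

theorem not_finiteDimensional_continuousMap :
    ¬ FiniteDimensional ℝ C(Set.Icc (0 : ℝ) 1, ℝ) := by
  intro h
  have hinj : Function.Injective (Polynomial.toContinuousMapOnAlgHom (Set.Icc (0 : ℝ) 1)) := by
    intro p q hpq
    refine Polynomial.eq_of_infinite_eval_eq p q ((Set.Icc_infinite zero_lt_one).mono ?_)
    intro x hx
    exact congrArg (fun g : C(Set.Icc (0 : ℝ) 1, ℝ) => g ⟨x, hx⟩) hpq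
  exact Polynomial.not_finite (Module.Finite.of_injective
    (Polynomial.toContinuousMapOnAlgHom (Set.Icc (0 : ℝ) 1)).toLinearMap hinj)

theorem theoremA :
    (∃ (X : Type) (_ : NormedAddCommGroup X) (_ : NormedSpace ℝ X),
      CompleteSpace X ∧ TopologicalSpace.SeparableSpace X ∧ ¬ FiniteDimensional ℝ X ∧
      LocallyUniformlyConvex X ∧ NearestPointMapsNotUniform X) ∧
    (∀ (ε : ℝ), 0 < ε → ∀ (X : Type u) [NormedAddCommGroup X] [NormedSpace ℝ X]
      [CompleteSpace X] [TopologicalSpace.SeparableSpace X], ¬ FiniteDimensional ℝ X →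
      ∃ (Y : Type u) (_ : NormedAddCommGroup Y) (_ : NormedSpace ℝ Y),
        CompleteSpace Y ∧ TopologicalSpace.SeparableSpace Y ∧
        LocallyUniformlyConvex Y ∧ NearestPointMapsNotUniform Y ∧
        IsomorphicWithConstant (1 + ε) X Y) := by
  refine ⟨?_, fun ε hε X _ _ _ _ hX => exists_renorming hε X hX⟩
  obtain ⟨Y, i1, i2, h1, h2, h3, h4, T, -⟩ := exists_renorming one_pos
    C(Set.Icc (0 : ℝ) 1, ℝ) not_finiteDimensional_continuousMap
  refine ⟨Y, i1, i2, h1, h2, fun hY => not_finiteDimensional_continuousMap ?_, h3, h4⟩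
  exact Module.Finite.equiv T.symm.toLinearEquiv
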